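/- Let $n\ge 3$, let $\Omega\subset\mathbb R^n$ be a bounded domain of class $C^1$ and let $q=\frac{2n}{n-2}$. Let $p\in H^1(\Omega)\cap C(\overline\Omega)$ satisfy $0<c_1\le p(x)\le c_2$ for all $x\in\overline\Omega$, with constants $c_1,c_2$, and let $g\in H^{1/2}(\partial\Omega)\cap C(\partial\Omega)$. Put $H^1_g(\Omega)=\{w\in H^1(\Omega): w=g \text{ on }\partial\Omega\}$ and let $\|\cdot\|_q$ be the norm of $L^q(\Omega)$. Let $v\in H^1_g(\Omega)$ be the weak solution of $$-\operatorname{div}(p\nabla v)=0\ \text{ in }\Omega,\qquad v=g\ \text{ on }\partial\Omega .$$ Let $u$ be a minimizer of $$S_0(p,g)=\inf\Big\{\int_\Omega p\,|\nabla w|^2\,dx \;:\; w\in H^1_g(\Omega),\ \|w\|_q=1\Big\}.$$ Then there is exactly one real number $\Lambda$ (the Lagrange multiplier of $u$) for which $u$ is a weak solution of the Euler–Lagrange equation $$-\operatorname{div}(p\nabla u)=\Lambda |u|^{q-2}u\ \text{ in }\Omega,\qquad u=g\ \text{ on }\partial\Omega$$ (the right-hand side is $\Lambda u^{q-1}$ if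 $u>0$), and its sign is as follows: if $\|v\|_q<1$, then $\Lambda>0$; if $\|v\|_q>1$, then $\Lambda<0$; and if $\|v\|_q=1$, then $\Lambda=0$. -/

import Mathlib

open MeasureTheory Set
open scoped ContDiff ENNReal

noncomputable section

namespace CriticalDirichlet

/-- Euclidean space `ℝⁿ`. -/
abbrev E (n : ℕ) : Type := EuclideanSpace ℝ (Fin n)

/-- A bounded domain (nonempty, open, connected) of class `C¹`: near each boundary point `x`, the set
is the negativity set of a `C¹` function which vanishes at `x` and whose derivative at `x` is not
zero (by the implicit function theorem: locally the region on one side of a `C¹` graph). -/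
structure IsBoundedC1Domain {n : ℕ} (Ω : Set (E n)) : Prop where
  isOpen : IsOpen Ω
  isConnected : IsConnected Ω
  isBounded : Bornology.IsBounded Ω
  boundary : ∀ x ∈ frontier Ω, ∃ (U : Set (E n)) (ψ : E n → ℝ), IsOpen U ∧ x ∈ U ∧
    ContDiffOn ℝ 1 ψ U ∧ ψ x = 0 ∧ fderiv ℝ ψ x ≠ 0 ∧ Ω ∩ U = {y ∈ U | ψ y < 0}

/-- `φ ∈ C_c^∞(Ω)`. -/
structure IsTest {n : ℕ} (Ω : Set (E n)) (φ : E n → ℝ) : Prop where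
  smooth : ContDiff ℝ ∞ φ
  compact : HasCompactSupport φ
  supp : tsupport φ ⊆ Ω

/-- The vector field `F ∈ L²(Ω)` is the weak gradient in `Ω` of the function `u`. -/
structure IsWeakGrad {n : ℕ} (Ω : Set (E n)) (u : E n → ℝ) (F : E n → E n) : Prop where
  memLp : MemLp F 2 (volume.restrict Ω)
  integral_eq : ∀ φ : E n → ℝ, IsTest Ω φ → ∀ e : E n,
    ∫ x in Ω, u x * fderiv ℝ φ x e = -∫ x in Ω, inner ℝ (F x) e * φ x

/-- `u ∈ H¹(Ω)`. Only the values of `u` on `Ω` matter. -/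
def MemH1 {n : ℕ} (Ω : Set (E n)) (u : E n → ℝ) : Prop :=
  MemLp u 2 (volume.restrict Ω) ∧ ∃ F : E n → E n, IsWeakGrad Ω u F

open Classical in
/-- The weak gradient of `u ∈ H¹(Ω)` (unique up to null sets of `Ω`; zero if there is none). -/
def weakGrad {n : ℕ} (Ω : Set (E n)) (u : E n → ℝ) : E n → E n :=
  if h : ∃ F : E n → E n, IsWeakGrad Ω u F then h.choose else 0

/-- `u ∈ H¹₀(Ω)`, the closure of `C_c^∞(Ω)` in `H¹(Ω)`. -/
def MemH10 {n : ℕ} (Ω : Set (E n)) (u : E n → ℝ) : Prop :=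
  MemH1 Ω u ∧ ∀ ε : ℝ≥0∞, 0 < ε → ∃ φ : E n → ℝ, IsTest Ω φ ∧
    eLpNorm (fun x => u x - φ x) 2 (volume.restrict Ω) < ε ∧
    eLpNorm (fun x => weakGrad Ω u x - gradient φ x) 2 (volume.restrict Ω) < ε

/-- `G ∈ H¹(Ω) ∩ C(Ω̄)` has the boundary values `g`. -/
structure IsExtension {n : ℕ} (Ω : Set (E n)) (g : frontier Ω → ℝ) (G : E n → ℝ) : Prop where
  memH1 : MemH1 Ω G
  continuousOn : ContinuousOn G (closure Ω)
  eq_boundary : ∀ x : frontier Ω, G x = g x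

/-- `g ∈ H^{1/2}(∂Ω) ∩ C(∂Ω)`. Here `H^{1/2}(∂Ω)` is the space of boundary values of functions in
`H¹(Ω)`; those of its elements that are continuous on `∂Ω` are exactly the restrictions to `∂Ω` of
functions in `H¹(Ω) ∩ C(Ω̄)`. -/
def IsBoundaryDatum {n : ℕ} (Ω : Set (E n)) (g : frontier Ω → ℝ) : Prop :=
  Continuous g ∧ ∃ G : E n → ℝ, IsExtension Ω g G

/-- The affine space `H¹_g(Ω)` of all `u ∈ H¹(Ω)` with `u = g` on `∂Ω`, that is, `u - G ∈ H¹₀(Ω)`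
for the extensions `G ∈ H¹(Ω) ∩ C(Ω̄)` of the datum `g`. As the difference of two extensions is in
`H¹₀(Ω)`, it is the same to ask this for one extension or for all of them; there has to be one. -/
def H1g {n : ℕ} (Ω : Set (E n)) (g : frontier Ω → ℝ) : Set (E n → ℝ) :=
  {u | IsBoundaryDatum Ω g ∧ MemH1 Ω u ∧
    ∀ G : E n → ℝ, IsExtension Ω g G → MemH10 Ω (fun x => u x - G x)}

/-- The critical Sobolev exponent `q = 2n/(n-2)`. -/
def critExp (n : ℕ) : ℝ := 2 * (n : ℝ) / ((n : ℝ) - 2)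

/-- The norm `‖u‖_q` of `L^q(Ω)` for the critical exponent `q`, with values in `[0,∞]`. -/
def critNorm {n : ℕ} (Ω : Set (E n)) (u : E n → ℝ) : ℝ≥0∞ :=
  eLpNorm u (ENNReal.ofReal (critExp n)) (volume.restrict Ω)

/-- The energy `∫_Ω p |∇u|²`. -/
def energy {n : ℕ} (Ω : Set (E n)) (p u : E n → ℝ) : ℝ :=
  ∫ x in Ω, p x * ‖weakGrad Ω u x‖ ^ 2

/-- The admissible set `Σ_g` of all `u ∈ H¹_g(Ω)` with `‖u‖_q = 1`. -/
def admissible {n : ℕ} (Ω : Set (E n)) (g : frontier Ω → ℝ) : Set (E n → ℝ) :=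
  {u | u ∈ H1g Ω g ∧ critNorm Ω u = 1}

/-- `u` is a minimizer of `S₀(p,g)`, the infimum over `Σ_g` of the energy. -/
def IsMinimizer {n : ℕ} (Ω : Set (E n)) (p : E n → ℝ) (g : frontier Ω → ℝ)
    (u : E n → ℝ) : Prop :=
  u ∈ admissible Ω g ∧ IsMinOn (energy Ω p) (admissible Ω g) u

/-- `u` satisfies `-div(p∇u) = f` in `Ω` in the weak sense. -/
def WeakEq {n : ℕ} (Ω : Set (E n)) (p u f : E n → ℝ) : Prop :=
  ∀ φ : E n → ℝ, IsTest Ω φ →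
    ∫ x in Ω, p x * inner ℝ (weakGrad Ω u x) (gradient φ x) = ∫ x in Ω, f x * φ x

/-- `v` is a weak solution of `-div(p∇v) = 0` in `Ω`, `v = g` on `∂Ω`. -/
def SolvesDirichlet {n : ℕ} (Ω : Set (E n)) (p : E n → ℝ) (g : frontier Ω → ℝ)
    (v : E n → ℝ) : Prop :=
  v ∈ H1g Ω g ∧ WeakEq Ω p v (fun _ => 0)

/-- The Euler-Lagrange equation `-div(p∇u) = Λ |u|^{q-2} u` in `Ω`, whose right-hand side is
`Λ u^{q-1}` where `u > 0`: the number `Λ` is a Lagrange multiplier of `u`. -/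
def EulerLagrange {n : ℕ} (Ω : Set (E n)) (p u : E n → ℝ) (Λ : ℝ) : Prop :=
  WeakEq Ω p u (fun x => Λ * (|u x| ^ (critExp n - 2) * u x))

end CriticalDirichlet

end

/-!
Write `q` for the critical exponent, `N(w) = ∫_Ω |w|^q`, `⟨a, b⟩ = ∫_Ω p ∇a · ∇b` and
`ℓ(φ) = ∫_Ω |u|^(q-2) u φ`, which is `1/q` times the derivative of `N` at `u`.

*Existence and uniqueness of the multiplier.* If `φ ∈ H¹₀(Ω)` satisfies `ℓ(φ) = 0`, then `⟨u, φ⟩ = 0`: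
otherwise the energy decreases to first order in the direction `φ` or `-φ`, and a small correction
by a transversal direction, found with the intermediate value theorem, brings the competitor back
to the constraint `N = 1` (`IsMinimizer.dirichletForm_nonneg`). As `‖u‖_q = 1`, some test function
has `ℓ(ψ) ≠ 0`, so `⟨u, ·⟩ = Λ ℓ` for exactly one `Λ`
(`IsMinimizer.existsUnique_eulerLagrange`).

*Sign.* The function `w = u - v` is in `H¹₀(Ω)`. By density and the Sobolev inequality the equations
of `u` and `v` may be tested with `w` (`WeakEq.dirichletForm_eq`), and subtracting them gives
`⟨w, w⟩ = ⟨u, w⟩ = Λ ℓ(w)`, where `ℓ(w) = 1 - ℓ(v)`. Unless `‖v‖_q = 1`, the left-hand side is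
positive, by the Sobolev inequality again.
* If `‖v‖_q < 1`, then `ℓ(v) < 1` by Hölder's inequality, so that `Λ > 0`.
* If `‖v‖_q > 1`, the energy is strictly decreasing on the segment from `u` to `v`. Were `ℓ(w) > 0`,
  then `N` would first drop below `1` on this segment and later return to `1`, at a competitor with
  less energy than `u`. So `ℓ(w) ≤ 0`, and `Λ < 0`
  (`IsMinimizer.integral_dualPow_mul_sub_nonpos`).
* If `‖v‖_q = 1`, then `v` is a competitor, which gives `⟨w, w⟩ ≤ 0` and `∇u = ∇v`; the equation of
  `v` then shows `Λ ℓ = 0`.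
-/

namespace CriticalDirichlet

open Filter Topology

/-! ### Hölder pairings and the derivative of `∫ |a + t b| ^ q` -/

section Pairing

variable {α : Type*}

/-- The duality map `a ↦ |a| ^ (q - 2) a` of `L^q`, with values in the dual space `L^(q/(q-1))`; up
to the factor `q` it is the derivative of `a ↦ ∫ |a| ^ q`. -/
noncomputable def dualPow (q : ℝ) (a : α → ℝ) : α → ℝ := fun x => |a x| ^ (q - 2) * a x

theorem abs_dualPow {q : ℝ} (hq : 1 < q) (a : α → ℝ) (x : α) :
    |dualPow q a x| = |a x| ^ (q - 1) := by
  rw [dualPow, abs_mul, abs_of_nonneg (Real.rpow_nonneg (abs_nonneg _) _)]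
  rcases (abs_nonneg (a x)).eq_or_lt with h | h
  · rw [← h, mul_zero, Real.zero_rpow (by linarith)]
  · rw [← Real.rpow_add_one h.ne']
    ring_nf

theorem dualPow_mul_self {q : ℝ} (hq : 1 < q) (a : α → ℝ) (x : α) :
    dualPow q a x * a x = |a x| ^ q := by
  have h : dualPow q a x * a x = |dualPow q a x| * |a x| := by
    rw [dualPow, abs_mul, abs_of_nonneg (Real.rpow_nonneg (abs_nonneg _) _), mul_assoc, mul_assoc,
      abs_mul_abs_self]
  rw [h, abs_dualPow hq]
  rcases (abs_nonneg (a x)).eq_or_lt with h | h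
  · rw [← h, mul_zero, Real.zero_rpow (by linarith)]
  · rw [← Real.rpow_add_one h.ne']
    ring_nf

variable [MeasurableSpace α] {μ : Measure α}

theorem integrable_inner_of_holderTriple {V : Type*} [NormedAddCommGroup V]
    [InnerProductSpace ℝ V] {r s : ℝ≥0∞} [r.HolderTriple s 1] {f g : α → V}
    (hf : MemLp f r μ) (hg : MemLp g s μ) : Integrable (fun x => inner ℝ (f x) (g x)) μ := by
  rw [← memLp_one_iff_integrable]
  refine MemLp.of_bilin (p := r) (q := s) (fun a b => inner ℝ a b) 1 hf hg
    (hf.aestronglyMeasurable.inner hg.aestronglyMeasurable) (Eventually.of_forall fun x => ?_)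
  rw [one_mul]
  exact nnnorm_inner_le_nnnorm _ _

theorem tendsto_integral_inner_of_tendsto_eLpNorm {V : Type*} [NormedAddCommGroup V]
    [InnerProductSpace ℝ V] {r s : ℝ≥0∞} [r.HolderTriple s 1] {f g : α → V} {G : ℕ → α → V}
    (hf : MemLp f r μ) (hg : MemLp g s μ) (hG : ∀ k, MemLp (G k) s μ)
    (hlim : Tendsto (fun k => eLpNorm (fun x => g x - G k x) s μ) atTop (𝓝 0)) :
    Tendsto (fun k => ∫ x, inner ℝ (f x) (G k x) ∂μ) atTop (𝓝 (∫ x, inner ℝ (f x) (g x) ∂μ)) := by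
  have hbound : ∀ k, ‖(∫ x, inner ℝ (f x) (G k x) ∂μ) - ∫ x, inner ℝ (f x) (g x) ∂μ‖ₑ ≤
      eLpNorm f r μ * eLpNorm (fun x => g x - G k x) s μ := by
    intro k
    rw [← integral_sub (integrable_inner_of_holderTriple hf (hG k))
      (integrable_inner_of_holderTriple hf hg)]
    refine (enorm_integral_le_lintegral_enorm _).trans ?_
    have h := eLpNorm_le_eLpNorm_mul_eLpNorm_of_nnnorm (p := r) (q := s) (r := 1)
      hf.aestronglyMeasurable
      ((hg.sub (hG k)).aestronglyMeasurable) (fun a b => inner ℝ a b : V → V → ℝ) 1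
      (Eventually.of_forall fun x => by rw [one_mul]; exact nnnorm_inner_le_nnnorm _ _)
    rw [eLpNorm_one_eq_lintegral_enorm, ENNReal.coe_one, one_mul] at h
    refine le_trans (le_of_eq (lintegral_congr fun x => ?_)) h
    rw [← inner_sub_right, ← enorm_neg, ← inner_neg_right, neg_sub]
    rfl
  have hz : Tendsto (fun k => eLpNorm f r μ * eLpNorm (fun x => g x - G k x) s μ) atTop (𝓝 0) := by
    simpa using ENNReal.Tendsto.const_mul hlim (Or.inr hf.eLpNorm_lt_top.ne)
  rw [tendsto_iff_edist_tendsto_0]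
  refine tendsto_of_tendsto_of_tendsto_of_le_of_le tendsto_const_nhds hz (fun _ => zero_le) ?_
  intro k
  simpa [edist_eq_enorm_sub] using hbound k

theorem memLp_dualPow {q : ℝ} (hq : 1 < q) {a : α → ℝ} (ha : MemLp a (ENNReal.ofReal q) μ) :
    MemLp (dualPow q a) (ENNReal.ofReal (q / (q - 1))) μ := by
  have h := ha.norm_rpow_div (ENNReal.ofReal (q - 1))
  rw [← ENNReal.ofReal_div_of_pos (by linarith), ENNReal.toReal_ofReal (by linarith)] at h
  refine h.mono ?_ (Eventually.of_forall fun x => ?_)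
  · have := ha.aestronglyMeasurable.aemeasurable
    exact (AEMeasurable.mul (this.abs.pow_const _) this).aestronglyMeasurable
  · rw [Real.norm_eq_abs, abs_dualPow hq, Real.norm_eq_abs, Real.norm_eq_abs,
      abs_of_nonneg (Real.rpow_nonneg (abs_nonneg _) _)]

theorem holderConjugate_dual {q : ℝ} (hq : 1 < q) : (q / (q - 1)).HolderConjugate q := by
  have := (Real.HolderConjugate.conjExponent hq).symm
  simpa [Real.conjExponent] using this

theorem holderTriple_dual {q : ℝ} (hq : 1 < q) :
    (ENNReal.ofReal (q / (q - 1))).HolderTriple (ENNReal.ofReal q) 1 :=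
  (holderConjugate_dual hq).ennrealOfReal

theorem integrable_abs_rpow {q : ℝ} (hq : 1 < q) {a : α → ℝ}
    (ha : MemLp a (ENNReal.ofReal q) μ) : Integrable (fun x => |a x| ^ q) μ := by
  have h := ha.integrable_norm_rpow (by simp; linarith) ENNReal.ofReal_ne_top
  rwa [ENNReal.toReal_ofReal (by linarith)] at h

theorem integrable_dualPow_mul {q : ℝ} (hq : 1 < q) {a b : α → ℝ}
    (ha : MemLp a (ENNReal.ofReal q) μ) (hb : MemLp b (ENNReal.ofReal q) μ) :
    Integrable (fun x => dualPow q a x * b x) μ := by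
  have := holderTriple_dual hq
  have h := integrable_inner_of_holderTriple (memLp_dualPow hq ha) hb
  simpa [mul_comm] using h

theorem integral_dualPow_mul_lt_one {q : ℝ} (hq : 1 < q) {a b : α → ℝ}
    (ha : MemLp a (ENNReal.ofReal q) μ) (hb : MemLp b (ENNReal.ofReal q) μ)
    (ha1 : ∫ x, |a x| ^ q ∂μ = 1) (hb1 : ∫ x, |b x| ^ q ∂μ < 1) :
    ∫ x, dualPow q a x * b x ∂μ < 1 := by
  have h := integral_mul_norm_le_Lp_mul_Lq (holderConjugate_dual hq) (memLp_dualPow hq ha) hb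
  have h1 : ∀ x, ‖dualPow q a x‖ ^ (q / (q - 1)) = |a x| ^ q := fun x => by
    rw [Real.norm_eq_abs, abs_dualPow hq, ← Real.rpow_mul (abs_nonneg _)]
    congr 1
    field_simp [show q - 1 ≠ 0 by linarith]
  simp only [h1, ha1, Real.one_rpow, one_mul] at h
  calc ∫ x, dualPow q a x * b x ∂μ ≤ ∫ x, ‖dualPow q a x‖ * ‖b x‖ ∂μ := by
        refine integral_mono (integrable_dualPow_mul hq ha hb) ?_ fun x => ?_
        · simpa using (integrable_dualPow_mul hq ha hb).norm
        · rw [← norm_mul]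
          exact le_abs_self _
    _ ≤ _ := h
    _ < 1 := Real.rpow_lt_one (integral_nonneg fun x => Real.rpow_nonneg (abs_nonneg _) _) hb1
        (by positivity)

/-- Differentiation under the integral sign: for `|t - t₀| < 1` the derivative of the integrand is
bounded by `q (|a| + (|t₀| + 1) |b|) ^ q`, as this base majorizes both `|a + t b|` and `|b|`. -/
theorem hasDerivAt_integral_abs_rpow {q : ℝ} (hq : 1 < q) {a b : α → ℝ}
    (ha : MemLp a (ENNReal.ofReal q) μ) (hb : MemLp b (ENNReal.ofReal q) μ) (t₀ : ℝ) :
    HasDerivAt (fun t : ℝ => ∫ x, |a x + t * b x| ^ q ∂μ)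
      (q * ∫ x, dualPow q (fun x => a x + t₀ * b x) x * b x ∂μ) t₀ := by
  have hab : ∀ t : ℝ, MemLp (fun x => a x + t * b x) (ENNReal.ofReal q) μ := fun t =>
    ha.add (hb.const_mul t)
  have hM : MemLp (fun x => |a x| + (|t₀| + 1) * |b x|) (ENNReal.ofReal q) μ :=
    ha.abs.add (hb.abs.const_mul _)
  have key := hasDerivAt_integral_of_dominated_loc_of_deriv_le (μ := μ)
    (F := fun t x => |a x + t * b x| ^ q)
    (F' := fun t x => q * (dualPow q (fun x => a x + t * b x) x * b x))
    (x₀ := t₀) (s := Metric.ball t₀ 1)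
    (bound := fun x => q * |(|a x| + (|t₀| + 1) * |b x|)| ^ q) (Metric.ball_mem_nhds _ one_pos)
    (Eventually.of_forall fun t => (integrable_abs_rpow hq (hab t)).aestronglyMeasurable)
    (integrable_abs_rpow hq (hab t₀))
    ((integrable_dualPow_mul hq (hab t₀) hb).const_mul q).aestronglyMeasurable
    (Eventually.of_forall fun x t ht => ?_)
    ((integrable_abs_rpow hq hM).const_mul q)
    (Eventually.of_forall fun x t _ => ?_)
  · simpa [integral_const_mul] using key.2
  · have ht' : |t| ≤ |t₀| + 1 := by
      rw [Metric.mem_ball, Real.dist_eq] at ht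
      have := abs_sub_abs_le_abs_sub t t₀
      linarith
    have hm0 : 0 ≤ |a x| + (|t₀| + 1) * |b x| := by positivity
    have h1 : |a x + t * b x| ≤ |a x| + (|t₀| + 1) * |b x| := by
      refine (abs_add_le _ _).trans ?_
      rw [abs_mul]
      gcongr
    have h2 : |b x| ≤ |a x| + (|t₀| + 1) * |b x| := by
      nlinarith [abs_nonneg (a x), abs_nonneg (b x), abs_nonneg t₀,
        mul_nonneg (abs_nonneg t₀) (abs_nonneg (b x))]
    rw [Real.norm_eq_abs, abs_mul, abs_mul, abs_of_pos (by linarith : 0 < q), abs_dualPow hq,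
      abs_of_nonneg hm0]
    gcongr
    calc |a x + t * b x| ^ (q - 1) * |b x|
        ≤ (|a x| + (|t₀| + 1) * |b x|) ^ (q - 1) * (|a x| + (|t₀| + 1) * |b x|) := by
          gcongr
      _ = (|a x| + (|t₀| + 1) * |b x|) ^ q := by
          rcases hm0.eq_or_lt with h | h
          · rw [← h, mul_zero, Real.zero_rpow (by linarith)]
          · rw [← Real.rpow_add_one h.ne']
            ring_nf
  · have h1 : HasDerivAt (fun t : ℝ => a x + t * b x) (b x) t := by
      simpa using ((hasDerivAt_id t).mul_const (b x)).const_add (a x)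
    have h2 := (hasDerivAt_abs_rpow (a x + t * b x) hq).comp t h1
    refine h2.congr_deriv ?_
    simp only [dualPow]
    ring

theorem continuous_integral_abs_rpow {q : ℝ} (hq : 1 < q) {a b : α → ℝ}
    (ha : MemLp a (ENNReal.ofReal q) μ) (hb : MemLp b (ENNReal.ofReal q) μ) :
    Continuous (fun t : ℝ => ∫ x, |a x + t * b x| ^ q ∂μ) :=
  continuous_iff_continuousAt.2 fun t => (hasDerivAt_integral_abs_rpow hq ha hb t).continuousAt

theorem eLpNorm_eq_integral_abs_rpow {q : ℝ} (hq : 1 < q) {a : α → ℝ}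
    (ha : MemLp a (ENNReal.ofReal q) μ) :
    eLpNorm a (ENNReal.ofReal q) μ = ENNReal.ofReal ((∫ x, |a x| ^ q ∂μ) ^ q⁻¹) := by
  have h := ha.eLpNorm_eq_integral_rpow_norm (by simp; linarith) ENNReal.ofReal_ne_top
  rwa [ENNReal.toReal_ofReal (by linarith)] at h

theorem integral_abs_rpow_nonneg (q : ℝ) (a : α → ℝ) : 0 ≤ ∫ x, |a x| ^ q ∂μ :=
  integral_nonneg fun _ => Real.rpow_nonneg (abs_nonneg _) _

theorem eLpNorm_lt_one_iff_integral {q : ℝ} (hq : 1 < q) {a : α → ℝ}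
    (ha : MemLp a (ENNReal.ofReal q) μ) :
    eLpNorm a (ENNReal.ofReal q) μ < 1 ↔ ∫ x, |a x| ^ q ∂μ < 1 := by
  have h0 : (0 : ℝ) < q⁻¹ := by positivity
  rw [eLpNorm_eq_integral_abs_rpow hq ha, ENNReal.ofReal_lt_one, ← Real.one_rpow q⁻¹,
    Real.rpow_lt_rpow_iff (integral_abs_rpow_nonneg q a) zero_le_one h0, Real.one_rpow]

theorem one_lt_eLpNorm_iff_integral {q : ℝ} (hq : 1 < q) {a : α → ℝ}
    (ha : MemLp a (ENNReal.ofReal q) μ) :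
    1 < eLpNorm a (ENNReal.ofReal q) μ ↔ 1 < ∫ x, |a x| ^ q ∂μ := by
  have h0 : (0 : ℝ) < q⁻¹ := by positivity
  rw [eLpNorm_eq_integral_abs_rpow hq ha, ENNReal.one_lt_ofReal, ← Real.one_rpow q⁻¹,
    Real.rpow_lt_rpow_iff zero_le_one (integral_abs_rpow_nonneg q a) h0, Real.one_rpow]

theorem eLpNorm_eq_one_iff_integral {q : ℝ} (hq : 1 < q) {a : α → ℝ}
    (ha : MemLp a (ENNReal.ofReal q) μ) :
    eLpNorm a (ENNReal.ofReal q) μ = 1 ↔ ∫ x, |a x| ^ q ∂μ = 1 := by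
  have h1 := eLpNorm_lt_one_iff_integral hq ha
  have h2 := one_lt_eLpNorm_iff_integral hq ha
  constructor <;> intro h
  · rw [h] at h1 h2
    simp only [lt_self_iff_false, false_iff, not_lt] at h1 h2
    exact le_antisymm h2 h1
  · rw [h] at h1 h2
    simp only [lt_self_iff_false, iff_false, not_lt] at h1 h2
    exact le_antisymm h2 h1

end Pairing

/-! ### Calculus of weak gradients -/

section WeakGradient

variable {n : ℕ} {Ω : Set (E n)}

theorem IsTest.memLp {φ : E n → ℝ} (hφ : IsTest Ω φ) (r : ℝ≥0∞) :
    MemLp φ r (volume.restrict Ω) :=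
  (hφ.smooth.continuous.memLp_of_hasCompactSupport hφ.compact).restrict Ω

theorem IsTest.continuous_fderiv {φ : E n → ℝ} (hφ : IsTest Ω φ) : Continuous (fderiv ℝ φ) :=
  hφ.smooth.continuous_fderiv (by simp)

theorem IsTest.memLp_fderiv_apply {φ : E n → ℝ} (hφ : IsTest Ω φ) (e : E n) (r : ℝ≥0∞) :
    MemLp (fun x => fderiv ℝ φ x e) r (volume.restrict Ω) :=
  ((hφ.continuous_fderiv.clm_apply continuous_const).memLp_of_hasCompactSupport
    (hφ.compact.fderiv_apply (𝕜 := ℝ) e)).restrict Ω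

theorem norm_gradient (φ : E n → ℝ) (x : E n) : ‖gradient φ x‖ = ‖fderiv ℝ φ x‖ :=
  LinearIsometryEquiv.norm_map _ _

theorem IsTest.memLp_gradient {φ : E n → ℝ} (hφ : IsTest Ω φ) (r : ℝ≥0∞) :
    MemLp (gradient φ) r (volume.restrict Ω) := by
  refine (Continuous.memLp_of_hasCompactSupport ?_ ?_).restrict Ω
  · exact (InnerProductSpace.toDual ℝ (E n)).symm.continuous.comp hφ.continuous_fderiv
  · exact (hφ.compact.fderiv (𝕜 := ℝ)).comp_left (map_zero _)

theorem IsTest.isWeakGrad {φ : E n → ℝ} (hφ : IsTest Ω φ) : IsWeakGrad Ω φ (gradient φ) := by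
  refine ⟨hφ.memLp_gradient 2, fun ψ hψ e => ?_⟩
  have hdφ := hφ.smooth.differentiable (by simp)
  have hdψ := hψ.smooth.differentiable (by simp)
  have hz : ∀ x ∉ Ω, φ x = 0 := fun x hx =>
    image_eq_zero_of_notMem_tsupport fun h => hx (hφ.supp h)
  have hz' : ∀ x ∉ Ω, ψ x = 0 := fun x hx =>
    image_eq_zero_of_notMem_tsupport fun h => hx (hψ.supp h)
  rw [setIntegral_eq_integral_of_forall_compl_eq_zero (fun x hx => by rw [hz x hx, zero_mul]),
    setIntegral_eq_integral_of_forall_compl_eq_zero (fun x hx => by rw [hz' x hx, mul_zero])]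
  have hcφ := hφ.continuous_fderiv.clm_apply (continuous_const (y := e))
  have hcψ := hψ.continuous_fderiv.clm_apply (continuous_const (y := e))
  simp only [inner_gradient_left]
  exact integral_mul_fderiv_eq_neg_fderiv_mul_of_integrable
    ((hcφ.mul hψ.smooth.continuous).integrable_of_hasCompactSupport hψ.compact.mul_left)
    ((hφ.smooth.continuous.mul hcψ).integrable_of_hasCompactSupport hφ.compact.mul_right)
    ((hφ.smooth.continuous.mul hψ.smooth.continuous).integrable_of_hasCompactSupport
      hφ.compact.mul_right) (fun x _ => hdφ x) (fun x _ => hdψ x)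

/-- Weak gradients are unique up to null sets, by the fundamental lemma of the calculus of variations
(applied to the vector field `F - F'`, one inner product with a constant vector at a time). -/
theorem IsWeakGrad.ae_eq (hΩ : IsOpen Ω) {u : E n → ℝ} {F F' : E n → E n}
    (hF : IsWeakGrad Ω u F) (hF' : IsWeakGrad Ω u F') : F =ᵐ[volume.restrict Ω] F' := by
  have hd := hF.memLp.sub hF'.memLp
  have hloc : LocallyIntegrableOn (F - F') Ω volume :=
    locallyIntegrableOn_of_locallyIntegrable_restrict (hd.locallyIntegrable (by norm_num))
  have h0 : ∀ᵐ x, x ∈ Ω → (F - F') x = 0 := by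
    refine hΩ.ae_eq_zero_of_integral_contDiff_smul_eq_zero hloc fun φ h1 h2 h3 => ?_
    have hφ : IsTest Ω φ := ⟨h1, h2, h3⟩
    rw [← setIntegral_eq_integral_of_forall_compl_eq_zero (s := Ω) (fun x hx => by
      rw [image_eq_zero_of_notMem_tsupport fun h => hx (h3 h), zero_smul])]
    have hint : Integrable (fun x => φ x • (F - F') x) (volume.restrict Ω) :=
      memLp_one_iff_integrable.1 (hd.smul (p := 2) (q := 2) (hφ.memLp 2))
    refine integral_eq_zero_of_forall_integral_inner_eq_zero ℝ _ hint fun e => ?_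
    have hi : ∀ G : E n → E n, MemLp G 2 (volume.restrict Ω) →
        Integrable (fun x => inner ℝ (G x) e * φ x) (volume.restrict Ω) := fun G hG =>
      (hG.inner_const e).integrable_mul (hφ.memLp 2)
    have h4 := hF.integral_eq φ hφ e
    rw [hF'.integral_eq φ hφ e, neg_inj] at h4
    have h5 := integral_sub (hi F hF.memLp) (hi F' hF'.memLp)
    rw [h4, sub_self] at h5
    rw [← h5]
    refine integral_congr_ae (Eventually.of_forall fun x => ?_)
    simp only [Pi.sub_apply, inner_smul_right, inner_sub_right, real_inner_comm e]
    ring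
  filter_upwards [(ae_restrict_iff' hΩ.measurableSet).2 h0] with x hx
  exact sub_eq_zero.1 hx

theorem MemH1.isWeakGrad {u : E n → ℝ} (hu : MemH1 Ω u) : IsWeakGrad Ω u (weakGrad Ω u) := by
  rw [weakGrad, dif_pos hu.2]
  exact hu.2.choose_spec

theorem IsWeakGrad.weakGrad_ae_eq (hΩ : IsOpen Ω) {u : E n → ℝ} {F : E n → E n}
    (hF : IsWeakGrad Ω u F) : weakGrad Ω u =ᵐ[volume.restrict Ω] F := by
  have h : ∃ F : E n → E n, IsWeakGrad Ω u F := ⟨F, hF⟩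
  have h' : IsWeakGrad Ω u (weakGrad Ω u) := by
    rw [weakGrad, dif_pos h]
    exact h.choose_spec
  exact h'.ae_eq hΩ hF

theorem MemH1.memLp_weakGrad {u : E n → ℝ} (hu : MemH1 Ω u) :
    MemLp (weakGrad Ω u) 2 (volume.restrict Ω) := hu.isWeakGrad.memLp

theorem IsWeakGrad.add_smul {u w : E n → ℝ} {F G : E n → E n}
    (hu : MemLp u 2 (volume.restrict Ω)) (hw : MemLp w 2 (volume.restrict Ω))
    (hF : IsWeakGrad Ω u F) (hG : IsWeakGrad Ω w G) (t : ℝ) :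
    IsWeakGrad Ω (fun x => u x + t * w x) (fun x => F x + t • G x) := by
  refine ⟨hF.memLp.add (hG.memLp.const_smul t), fun φ hφ e => ?_⟩
  have h1 : Integrable (fun x => u x * fderiv ℝ φ x e) (volume.restrict Ω) :=
    hu.integrable_mul (hφ.memLp_fderiv_apply e 2)
  have h2 : Integrable (fun x => w x * fderiv ℝ φ x e) (volume.restrict Ω) :=
    hw.integrable_mul (hφ.memLp_fderiv_apply e 2)
  have h3 : Integrable (fun x => inner ℝ (F x) e * φ x) (volume.restrict Ω) :=
    (hF.memLp.inner_const e).integrable_mul (hφ.memLp 2)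
  have h4 : Integrable (fun x => inner ℝ (G x) e * φ x) (volume.restrict Ω) :=
    (hG.memLp.inner_const e).integrable_mul (hφ.memLp 2)
  calc ∫ x in Ω, (u x + t * w x) * fderiv ℝ φ x e
      = ∫ x in Ω, (u x * fderiv ℝ φ x e + t * (w x * fderiv ℝ φ x e)) := by
        simp only [add_mul, mul_assoc]
    _ = -((∫ x in Ω, inner ℝ (F x) e * φ x) + t * ∫ x in Ω, inner ℝ (G x) e * φ x) := by
        rw [integral_add h1 (h2.const_mul t), integral_const_mul, hF.integral_eq φ hφ e,
          hG.integral_eq φ hφ e]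
        ring
    _ = -∫ x in Ω, inner ℝ (F x + t • G x) e * φ x := by
        rw [← integral_const_mul, ← integral_add h3 (h4.const_mul t)]
        simp only [inner_add_left, real_inner_smul_left, add_mul, mul_assoc]

theorem MemH1.add_smul {u w : E n → ℝ} (hu : MemH1 Ω u) (hw : MemH1 Ω w) (t : ℝ) :
    MemH1 Ω (fun x => u x + t * w x) :=
  ⟨hu.1.add (hw.1.const_mul t), _, hu.isWeakGrad.add_smul hu.1 hw.1 hw.isWeakGrad t⟩

theorem weakGrad_add_smul (hΩ : IsOpen Ω) {u w : E n → ℝ} (hu : MemH1 Ω u) (hw : MemH1 Ω w)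
    (t : ℝ) : weakGrad Ω (fun x => u x + t * w x) =ᵐ[volume.restrict Ω]
      fun x => weakGrad Ω u x + t • weakGrad Ω w x :=
  (hu.isWeakGrad.add_smul hu.1 hw.1 hw.isWeakGrad t).weakGrad_ae_eq hΩ

theorem IsTest.memH1 {φ : E n → ℝ} (hφ : IsTest Ω φ) : MemH1 Ω φ :=
  ⟨hφ.memLp 2, _, hφ.isWeakGrad⟩

theorem IsTest.add_smul {φ ψ : E n → ℝ} (hφ : IsTest Ω φ) (hψ : IsTest Ω ψ) (t : ℝ) :
    IsTest Ω (fun x => φ x + t * ψ x) where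
  smooth := hφ.smooth.add (contDiff_const.mul hψ.smooth)
  compact := hφ.compact.add hψ.compact.mul_left
  supp := by
    refine (tsupport_add φ fun x => t * ψ x).trans (union_subset hφ.supp ?_)
    exact (tsupport_mul_subset_right (f := fun _ => t)).trans hψ.supp

/-- Functions of `H¹₀(Ω)` are limits of sequences of test functions. -/
theorem MemH10.exists_seq {w : E n → ℝ} (hw : MemH10 Ω w) :
    ∃ φ : ℕ → E n → ℝ, (∀ k, IsTest Ω (φ k)) ∧
      Tendsto (fun k => eLpNorm (fun x => w x - φ k x) 2 (volume.restrict Ω)) atTop (𝓝 0) ∧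
      Tendsto (fun k => eLpNorm (fun x => weakGrad Ω w x - gradient (φ k) x) 2
        (volume.restrict Ω)) atTop (𝓝 0) := by
  obtain ⟨ε, -, hε, hlim⟩ := exists_seq_strictAnti_tendsto' (α := ℝ≥0∞) zero_lt_one
  choose φ h1 h2 h3 using fun k => hw.2 (ε k) (hε k).1
  exact ⟨φ, h1,
    tendsto_of_tendsto_of_tendsto_of_le_of_le tendsto_const_nhds hlim (fun _ => zero_le)
      fun k => (h2 k).le,
    tendsto_of_tendsto_of_tendsto_of_le_of_le tendsto_const_nhds hlim (fun _ => zero_le)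
      fun k => (h3 k).le⟩

theorem MemH10.of_seq {w : E n → ℝ} (hw : MemH1 Ω w) {φ : ℕ → E n → ℝ}
    (hφ : ∀ k, IsTest Ω (φ k))
    (h1 : Tendsto (fun k => eLpNorm (fun x => w x - φ k x) 2 (volume.restrict Ω)) atTop (𝓝 0))
    (h2 : Tendsto (fun k => eLpNorm (fun x => weakGrad Ω w x - gradient (φ k) x) 2
        (volume.restrict Ω)) atTop (𝓝 0)) : MemH10 Ω w := by
  refine ⟨hw, fun ε hε => ?_⟩
  obtain ⟨k, hk1, hk2⟩ := ((h1.eventually_lt_const hε).and (h2.eventually_lt_const hε)).exists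
  exact ⟨φ k, hφ k, hk1, hk2⟩

theorem IsTest.memH10 (hΩ : IsOpen Ω) {φ : E n → ℝ} (hφ : IsTest Ω φ) : MemH10 Ω φ := by
  refine ⟨hφ.memH1, fun ε hε => ⟨φ, hφ, by simpa using hε, ?_⟩⟩
  rw [eLpNorm_congr_ae (g := 0)]
  · simpa using hε
  · filter_upwards [hφ.isWeakGrad.weakGrad_ae_eq hΩ] with x hx
    simp [hx]

theorem gradient_add_smul {φ ψ : E n → ℝ} (hφ : IsTest Ω φ) (hψ : IsTest Ω ψ) (t : ℝ) (x : E n) :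
    gradient (fun x => φ x + t * ψ x) x = gradient φ x + t • gradient ψ x := by
  have h1 := (hφ.smooth.differentiable (by simp) x).hasGradientAt
  have h2 := (hψ.smooth.differentiable (by simp) x).hasGradientAt
  rw [hasGradientAt_iff_hasFDerivAt] at h1 h2
  refine HasGradientAt.gradient ?_
  rw [hasGradientAt_iff_hasFDerivAt, map_add, map_smul]
  exact h1.add (h2.const_mul t)

theorem tendsto_eLpNorm_add_smul {V : Type*} [NormedAddCommGroup V] [NormedSpace ℝ V]
    {α : Type*} [MeasurableSpace α] {μ : Measure α} {a b : ℕ → α → V}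
    (ha : ∀ k, AEStronglyMeasurable (a k) μ) (hb : ∀ k, AEStronglyMeasurable (b k) μ)
    (ha0 : Tendsto (fun k => eLpNorm (a k) 2 μ) atTop (𝓝 0))
    (hb0 : Tendsto (fun k => eLpNorm (b k) 2 μ) atTop (𝓝 0)) (t : ℝ) :
    Tendsto (fun k => eLpNorm (fun x => a k x + t • b k x) 2 μ) atTop (𝓝 0) := by
  have hz : Tendsto (fun k => eLpNorm (a k) 2 μ + ‖t‖ₑ * eLpNorm (b k) 2 μ) atTop (𝓝 0) := by
    simpa using ha0.add (ENNReal.Tendsto.const_mul hb0 (Or.inr enorm_ne_top))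
  refine tendsto_of_tendsto_of_tendsto_of_le_of_le tendsto_const_nhds hz (fun _ => zero_le) ?_
  intro k
  refine (eLpNorm_add_le (ha k) ((hb k).const_smul t) (by norm_num)).trans ?_
  rw [eLpNorm_const_smul]

theorem MemH10.add_smul (hΩ : IsOpen Ω) {u w : E n → ℝ} (hu : MemH10 Ω u) (hw : MemH10 Ω w)
    (t : ℝ) : MemH10 Ω (fun x => u x + t * w x) := by
  obtain ⟨φ, hφ, h1, h2⟩ := hu.exists_seq
  obtain ⟨ψ, hψ, h3, h4⟩ := hw.exists_seq
  refine MemH10.of_seq (hu.1.add_smul hw.1 t) (fun k => (hφ k).add_smul (hψ k) t) ?_ ?_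
  · refine (tendsto_eLpNorm_add_smul
      (fun k => (hu.1.1.sub ((hφ k).memLp 2)).aestronglyMeasurable)
      (fun k => (hw.1.1.sub ((hψ k).memLp 2)).aestronglyMeasurable) h1 h3 t).congr fun k => ?_
    congr 1
    ext x
    simp only [Pi.sub_apply, smul_eq_mul]
    ring
  · refine (tendsto_eLpNorm_add_smul
      (fun k => (hu.1.memLp_weakGrad.sub ((hφ k).memLp_gradient 2)).aestronglyMeasurable)
      (fun k => (hw.1.memLp_weakGrad.sub ((hψ k).memLp_gradient 2)).aestronglyMeasurable)
      h2 h4 t).congr fun k => ?_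
    refine eLpNorm_congr_ae ?_
    filter_upwards [weakGrad_add_smul hΩ hu.1 hw.1 t] with x hx
    rw [hx, gradient_add_smul (hφ k) (hψ k) t x, Pi.sub_apply, Pi.sub_apply, smul_sub]
    abel

end WeakGradient

/-! ### The Sobolev inequality in `H¹₀(Ω)` -/

section Sobolev

variable {n : ℕ} {Ω : Set (E n)}

theorem two_lt_critExp (hn : 3 ≤ n) : 2 < critExp n := by
  have h : (3 : ℝ) ≤ n := by exact_mod_cast hn
  rw [critExp, lt_div_iff₀ (by linarith)]
  linarith

theorem one_lt_critExp (hn : 3 ≤ n) : 1 < critExp n := by linarith [two_lt_critExp hn]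

theorem exists_critNorm_le_of_isTest (hn : 3 ≤ n) (Ω : Set (E n)) :
    ∃ C : ℝ≥0∞, C ≠ ⊤ ∧ ∀ φ : E n → ℝ, IsTest Ω φ →
      critNorm Ω φ ≤ C * eLpNorm (gradient φ) 2 (volume.restrict Ω) := by
  refine ⟨SNormLESNormFDerivOfEqConst ℝ (volume : Measure (E n)) ((2 : NNReal) : ℝ),
    ENNReal.coe_ne_top, fun φ hφ => ?_⟩
  have h3 : (3 : ℝ) ≤ n := by exact_mod_cast hn
  have h := eLpNorm_le_eLpNorm_fderiv_of_eq (volume : Measure (E n)) (p := 2)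
    (p' := (critExp n).toNNReal) (hφ.smooth.of_le (by simp)) hφ.compact (by norm_num)
    (by simp; omega) (by
      rw [Real.coe_toNNReal _ (by linarith [one_lt_critExp hn]), finrank_euclideanSpace,
        Fintype.card_fin, critExp]
      push_cast
      have h2 : (n : ℝ) - 2 ≠ 0 := by linarith
      field_simp)
  have hg : eLpNorm (gradient φ) 2 (volume.restrict Ω) = eLpNorm (fderiv ℝ φ) 2 volume := by
    rw [← eLpNorm_restrict_eq_of_support_subset (s := Ω) (f := fderiv ℝ φ)
      ((support_fderiv_subset ℝ).trans hφ.supp)]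
    exact eLpNorm_congr_norm_ae (Eventually.of_forall fun x => norm_gradient φ x)
  rw [hg, critNorm, eLpNorm_restrict_eq_of_support_subset ((subset_tsupport φ).trans hφ.supp)]
  exact h

/-- An inequality `‖φ‖_q ≤ C ‖∇φ‖₂` for test functions passes to `H¹₀(Ω)` by Fatou's lemma, applied
along an almost everywhere convergent subsequence of an approximating sequence. -/
theorem MemH10.critNorm_le {C : ℝ≥0∞} (hC : C ≠ ⊤)
    (hS : ∀ φ : E n → ℝ, IsTest Ω φ →
      critNorm Ω φ ≤ C * eLpNorm (gradient φ) 2 (volume.restrict Ω))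
    {w : E n → ℝ} (hw : MemH10 Ω w) :
    critNorm Ω w ≤ C * eLpNorm (weakGrad Ω w) 2 (volume.restrict Ω) := by
  obtain ⟨φ, hφ, h1, h2⟩ := hw.exists_seq
  have hm : TendstoInMeasure (volume.restrict Ω) φ atTop w := by
    refine tendstoInMeasure_of_tendsto_eLpNorm (p := 2) (by norm_num)
      (fun k => ((hφ k).memLp 2).aestronglyMeasurable) hw.1.1.aestronglyMeasurable ?_
    refine h1.congr fun k => ?_
    rw [← eLpNorm_neg]
    congr 1
    ext x
    simp
  obtain ⟨ns, hns, hae⟩ := hm.exists_seq_tendsto_ae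
  have hle := Lp.eLpNorm_lim_le_liminf_eLpNorm (p := ENNReal.ofReal (critExp n))
    (fun k => ((hφ (ns k)).memLp 2).aestronglyMeasurable) w hae
  refine hle.trans ?_
  have hbd : ∀ k, eLpNorm (φ (ns k)) (ENNReal.ofReal (critExp n)) (volume.restrict Ω) ≤
      C * (eLpNorm (weakGrad Ω w) 2 (volume.restrict Ω) +
        eLpNorm (fun x => weakGrad Ω w x - gradient (φ (ns k)) x) 2 (volume.restrict Ω)) := by
    intro k
    refine (hS _ (hφ (ns k))).trans ?_
    gcongr
    have hG := (hφ (ns k)).memLp_gradient 2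
    have := eLpNorm_sub_le (p := 2) hw.1.memLp_weakGrad.aestronglyMeasurable
      (hw.1.memLp_weakGrad.sub hG).aestronglyMeasurable (by norm_num)
    rwa [sub_sub_cancel] at this
  have hlim : Tendsto (fun k => C * (eLpNorm (weakGrad Ω w) 2 (volume.restrict Ω) +
        eLpNorm (fun x => weakGrad Ω w x - gradient (φ (ns k)) x) 2 (volume.restrict Ω))) atTop
      (𝓝 (C * eLpNorm (weakGrad Ω w) 2 (volume.restrict Ω))) := by
    have := ENNReal.Tendsto.const_mul (a := C)
      ((tendsto_const_nhds (x := eLpNorm (weakGrad Ω w) 2 (volume.restrict Ω))).add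
        (h2.comp hns.tendsto_atTop)) (Or.inr hC)
    simpa using this
  rw [← hlim.liminf_eq]
  exact liminf_le_liminf (Eventually.of_forall hbd)

/-- The Sobolev inequality `‖w‖_q ≤ C ‖∇w‖₂` in `H¹₀(Ω)`. -/
theorem exists_critNorm_le (hn : 3 ≤ n) (Ω : Set (E n)) :
    ∃ C : ℝ≥0∞, C ≠ ⊤ ∧ ∀ w : E n → ℝ, MemH10 Ω w →
      critNorm Ω w ≤ C * eLpNorm (weakGrad Ω w) 2 (volume.restrict Ω) := by
  obtain ⟨C, hC, hS⟩ := exists_critNorm_le_of_isTest hn Ω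
  exact ⟨C, hC, fun w hw => hw.critNorm_le hC hS⟩

theorem MemH10.memLp_critExp (hn : 3 ≤ n) {w : E n → ℝ} (hw : MemH10 Ω w) :
    MemLp w (ENNReal.ofReal (critExp n)) (volume.restrict Ω) := by
  obtain ⟨C, hC, hS⟩ := exists_critNorm_le hn Ω
  exact ⟨hw.1.1.aestronglyMeasurable, (hS w hw).trans_lt
    (ENNReal.mul_lt_top hC.lt_top hw.1.memLp_weakGrad.eLpNorm_lt_top)⟩

theorem MemH10.ae_eq_zero (hn : 3 ≤ n) {w : E n → ℝ} (hw : MemH10 Ω w)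
    (h : weakGrad Ω w =ᵐ[volume.restrict Ω] 0) : w =ᵐ[volume.restrict Ω] 0 := by
  obtain ⟨C, hC, hS⟩ := exists_critNorm_le hn Ω
  have h0 := hS w hw
  rw [eLpNorm_congr_ae h, eLpNorm_zero, mul_zero, nonpos_iff_eq_zero, critNorm,
    eLpNorm_eq_zero_iff hw.1.1.aestronglyMeasurable] at h0
  · exact h0
  · simpa using by linarith [one_lt_critExp hn]

end Sobolev

/-! ### The Dirichlet form -/

section Form

variable {n : ℕ} {Ω : Set (E n)} {p : E n → ℝ}

/-- The bilinear form `∫_Ω p ∇a · ∇b`, whose quadratic form is the energy. -/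
noncomputable def dirichletForm (Ω : Set (E n)) (p a b : E n → ℝ) : ℝ :=
  ∫ x in Ω, p x * inner ℝ (weakGrad Ω a x) (weakGrad Ω b x)

theorem dirichletForm_self (a : E n → ℝ) : dirichletForm Ω p a a = energy Ω p a := by
  simp only [dirichletForm, energy, real_inner_self_eq_norm_sq]

theorem dirichletForm_comm (a b : E n → ℝ) : dirichletForm Ω p a b = dirichletForm Ω p b a := by
  simp only [dirichletForm, real_inner_comm]

theorem memLp_smul_weakGrad (hp : MemLp p ⊤ (volume.restrict Ω)) {a : E n → ℝ} (ha : MemH1 Ω a) :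
    MemLp (fun x => p x • weakGrad Ω a x) 2 (volume.restrict Ω) :=
  MemLp.smul (p := ⊤) (q := 2) (r := 2) ha.memLp_weakGrad hp

theorem integrable_dirichletForm (hp : MemLp p ⊤ (volume.restrict Ω)) {a b : E n → ℝ}
    (ha : MemH1 Ω a) (hb : MemH1 Ω b) :
    Integrable (fun x => p x * inner ℝ (weakGrad Ω a x) (weakGrad Ω b x))
      (volume.restrict Ω) := by
  have := integrable_inner_of_holderTriple (memLp_smul_weakGrad hp ha) hb.memLp_weakGrad
  simpa only [real_inner_smul_left] using this

theorem dirichletForm_add_smul (hΩ : IsOpen Ω) (hp : MemLp p ⊤ (volume.restrict Ω))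
    {a b c : E n → ℝ} (ha : MemH1 Ω a) (hb : MemH1 Ω b) (hc : MemH1 Ω c) (t : ℝ) :
    dirichletForm Ω p (fun x => a x + t * b x) c =
      dirichletForm Ω p a c + t * dirichletForm Ω p b c := by
  rw [dirichletForm, dirichletForm, dirichletForm, ← integral_const_mul,
    ← integral_add (integrable_dirichletForm hp ha hc)
      ((integrable_dirichletForm hp hb hc).const_mul t)]
  refine integral_congr_ae ?_
  filter_upwards [weakGrad_add_smul hΩ ha hb t] with x hx
  rw [hx, inner_add_left, real_inner_smul_left]
  ring

theorem energy_add_smul (hΩ : IsOpen Ω) (hp : MemLp p ⊤ (volume.restrict Ω))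
    {a b : E n → ℝ} (ha : MemH1 Ω a) (hb : MemH1 Ω b) (t : ℝ) :
    energy Ω p (fun x => a x + t * b x) =
      energy Ω p a + 2 * t * dirichletForm Ω p a b + t ^ 2 * energy Ω p b := by
  have hab := ha.add_smul hb t
  rw [← dirichletForm_self, dirichletForm_add_smul hΩ hp ha hb hab, dirichletForm_comm a,
    dirichletForm_comm b, dirichletForm_add_smul hΩ hp ha hb ha,
    dirichletForm_add_smul hΩ hp ha hb hb, dirichletForm_comm b a, dirichletForm_self,
    dirichletForm_self]
  ring

theorem energy_nonneg (hpos : ∀ᵐ x ∂(volume.restrict Ω), 0 < p x) (a : E n → ℝ) :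
    0 ≤ energy Ω p a := by
  refine integral_nonneg_of_ae ?_
  filter_upwards [hpos] with x hx
  exact mul_nonneg hx.le (sq_nonneg _)

theorem weakGrad_ae_eq_zero_of_energy_eq_zero (hp : MemLp p ⊤ (volume.restrict Ω))
    (hpos : ∀ᵐ x ∂(volume.restrict Ω), 0 < p x) {a : E n → ℝ} (ha : MemH1 Ω a)
    (h : energy Ω p a = 0) : weakGrad Ω a =ᵐ[volume.restrict Ω] 0 := by
  have hi := integrable_dirichletForm hp ha ha
  simp only [real_inner_self_eq_norm_sq] at hi
  have h0 := (integral_eq_zero_iff_of_nonneg_ae (by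
    filter_upwards [hpos] with x hx
    exact mul_nonneg hx.le (sq_nonneg _)) hi).1 h
  filter_upwards [h0, hpos] with x hx hpx
  simpa [hpx.ne'] using hx

theorem weakEq_of_dirichletForm_eq (hΩ : IsOpen Ω) {a f : E n → ℝ}
    (h : ∀ φ, IsTest Ω φ → dirichletForm Ω p a φ = ∫ x in Ω, f x * φ x) : WeakEq Ω p a f := by
  intro φ hφ
  rw [← h φ hφ, dirichletForm]
  refine integral_congr_ae ?_
  filter_upwards [hφ.isWeakGrad.weakGrad_ae_eq hΩ] with x hx
  rw [hx]

/-- By density and the Sobolev inequality, a weak equation whose right-hand side is in the dual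
space of `L^q(Ω)` may be tested with all functions of `H¹₀(Ω)`. -/
theorem WeakEq.dirichletForm_eq (hn : 3 ≤ n) (hΩ : IsOpen Ω)
    (hp : MemLp p ⊤ (volume.restrict Ω)) {a f : E n → ℝ} (ha : MemH1 Ω a)
    (hf : MemLp f (ENNReal.ofReal (critExp n / (critExp n - 1))) (volume.restrict Ω))
    (h : WeakEq Ω p a f) {w : E n → ℝ} (hw : MemH10 Ω w) :
    dirichletForm Ω p a w = ∫ x in Ω, f x * w x := by
  obtain ⟨C, hC, hS⟩ := exists_critNorm_le hn Ω
  obtain ⟨φ, hφ, -, h2⟩ := hw.exists_seq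
  have hT := holderTriple_dual (one_lt_critExp hn)
  have hq : Tendsto (fun k => eLpNorm (fun x => w x - φ k x) (ENNReal.ofReal (critExp n))
      (volume.restrict Ω)) atTop (𝓝 0) := by
    have hz : Tendsto (fun k => C * eLpNorm (fun x => weakGrad Ω w x - gradient (φ k) x) 2
        (volume.restrict Ω)) atTop (𝓝 0) := by
      simpa using ENNReal.Tendsto.const_mul h2 (Or.inr hC)
    refine tendsto_of_tendsto_of_tendsto_of_le_of_le tendsto_const_nhds hz (fun _ => zero_le) ?_
    intro k
    have h3 := hS _ (hw.add_smul hΩ ((hφ k).memH10 hΩ) (-1))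
    rw [critNorm] at h3
    have h4 : eLpNorm (weakGrad Ω fun x => w x + -1 * φ k x) 2 (volume.restrict Ω) =
        eLpNorm (fun x => weakGrad Ω w x - gradient (φ k) x) 2 (volume.restrict Ω) := by
      refine eLpNorm_congr_ae ?_
      filter_upwards [weakGrad_add_smul hΩ hw.1 (hφ k).memH1 (-1),
        (hφ k).isWeakGrad.weakGrad_ae_eq hΩ] with x hx hx'
      rw [hx, hx', neg_one_smul, sub_eq_add_neg]
    rw [h4] at h3
    simpa only [neg_one_mul, ← sub_eq_add_neg] using h3
  have hl := tendsto_integral_inner_of_tendsto_eLpNorm (memLp_smul_weakGrad hp ha)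
    hw.1.memLp_weakGrad (fun k => (hφ k).memLp_gradient 2) h2
  have hr := tendsto_integral_inner_of_tendsto_eLpNorm hf (hw.memLp_critExp hn)
    (fun k => (hφ k).memLp _) hq
  have he : ∀ k, ∫ x in Ω, inner ℝ (p x • weakGrad Ω a x) (gradient (φ k) x) =
      ∫ x in Ω, inner ℝ (f x) (φ k x) := by
    intro k
    simp only [real_inner_smul_left, real_inner_eq_re_inner]
    rw [h (φ k) (hφ k)]
    simp [mul_comm]
  simp only [he] at hl
  have := tendsto_nhds_unique hl hr
  simp only [real_inner_smul_left] at this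
  rw [dirichletForm, this]
  simp [mul_comm]

end Form

/-! ### Variations of a minimizer -/

theorem eventually_lt_of_hasDerivAt_pos {f : ℝ → ℝ} {f' x : ℝ} (h : HasDerivAt f f' x)
    (hf' : 0 < f') : ∀ᶠ t in 𝓝[>] x, f x < f t := by
  have h1 := (hasDerivAt_iff_tendsto_slope.1 h).eventually_const_lt hf'
  filter_upwards [h1.filter_mono (nhdsWithin_mono x fun t ht => ne_of_gt ht),
    self_mem_nhdsWithin] with t ht htx
  rw [slope_def_field, div_pos_iff_of_pos_right (sub_pos.2 htx)] at ht
  linarith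

theorem eventually_gt_of_hasDerivAt_neg {f : ℝ → ℝ} {f' x : ℝ} (h : HasDerivAt f f' x)
    (hf' : f' < 0) : ∀ᶠ t in 𝓝[>] x, f t < f x := by
  filter_upwards [eventually_lt_of_hasDerivAt_pos h.neg (neg_pos.2 hf')] with t ht
  simpa using ht

section Minimizer

variable {n : ℕ} {Ω : Set (E n)} {p : E n → ℝ} {g : frontier Ω → ℝ}

theorem add_smul_mem_H1g (hΩ : IsOpen Ω) {u w : E n → ℝ} (hu : u ∈ H1g Ω g) (hw : MemH10 Ω w)
    (t : ℝ) : (fun x => u x + t * w x) ∈ H1g Ω g := by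
  refine ⟨hu.1, hu.2.1.add_smul hw.1 t, fun G hG => ?_⟩
  convert (hu.2.2 G hG).add_smul hΩ hw t using 2
  ring

theorem sub_memH10 (hΩ : IsOpen Ω) {u v : E n → ℝ} (hu : u ∈ H1g Ω g) (hv : v ∈ H1g Ω g) :
    MemH10 Ω (fun x => u x - v x) := by
  obtain ⟨G, hG⟩ := hu.1.2
  convert (hu.2.2 G hG).add_smul hΩ (hv.2.2 G hG) (-1) using 2
  ring

theorem memLp_of_mem_admissible {u : E n → ℝ} (hu : u ∈ admissible Ω g) :
    MemLp u (ENNReal.ofReal (critExp n)) (volume.restrict Ω) :=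
  ⟨hu.1.2.1.1.aestronglyMeasurable, by
    have h := hu.2
    rw [critNorm] at h
    rw [h]
    exact ENNReal.one_lt_top⟩

theorem integral_eq_one_of_mem_admissible (hn : 3 ≤ n) {u : E n → ℝ} (hu : u ∈ admissible Ω g) :
    ∫ x in Ω, |u x| ^ critExp n = 1 :=
  (eLpNorm_eq_one_iff_integral (one_lt_critExp hn) (memLp_of_mem_admissible hu)).1 hu.2

/-- A minimizer does not have more energy than any `u + t w` with `w ∈ H¹₀(Ω)` on the constraint. -/
theorem IsMinimizer.nonneg_of_integral_eq_one (hn : 3 ≤ n) (hΩ : IsOpen Ω)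
    (hp : MemLp p ⊤ (volume.restrict Ω)) {u w : E n → ℝ} (hu : IsMinimizer Ω p g u)
    (hw : MemH10 Ω w) {t : ℝ} (h : ∫ x in Ω, |u x + t * w x| ^ critExp n = 1) :
    0 ≤ 2 * t * dirichletForm Ω p u w + t ^ 2 * energy Ω p w := by
  have hmem : MemLp (fun x => u x + t * w x) (ENNReal.ofReal (critExp n)) (volume.restrict Ω) :=
    (memLp_of_mem_admissible hu.1).add ((hw.memLp_critExp hn).const_mul t)
  have hadm : (fun x => u x + t * w x) ∈ admissible Ω g :=
    ⟨add_smul_mem_H1g hΩ hu.1.1 hw t,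
      (eLpNorm_eq_one_iff_integral (one_lt_critExp hn) hmem).2 h⟩
  have hle : energy Ω p u ≤ energy Ω p (fun x => u x + t * w x) := hu.2 hadm
  rw [energy_add_smul hΩ hp hu.1.1.2.1 hw.1] at hle
  linarith

/-- A minimizer is stationary in directions tangent to the constraint. Were the energy to decrease
to first order in the tangent direction `φ`, it would do so uniformly in the directions
`φ + s ψ`, `|s| ≤ ε`; as `ψ` is transversal to the constraint, the intermediate value theorem gives
points `u + t (φ + s ψ)` on the constraint for all small `t > 0`. -/
theorem IsMinimizer.dirichletForm_nonneg (hn : 3 ≤ n) (hΩ : IsOpen Ω)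
    (hp : MemLp p ⊤ (volume.restrict Ω)) {u φ ψ : E n → ℝ} (hu : IsMinimizer Ω p g u)
    (hφ : MemH10 Ω φ) (hψ : MemH10 Ω ψ)
    (hφ0 : ∫ x in Ω, dualPow (critExp n) u x * φ x = 0)
    (hψ0 : 0 < ∫ x in Ω, dualPow (critExp n) u x * ψ x) : 0 ≤ dirichletForm Ω p u φ := by
  by_contra! hneg
  have hq := one_lt_critExp hn
  have huq := memLp_of_mem_admissible hu.1
  have hφq := hφ.memLp_critExp hn
  have hψq := hψ.memLp_critExp hn
  have hu1 := hu.1.1.2.1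
  set δ := -dirichletForm Ω p u φ / 2 with hδ
  have hδ0 : 0 < δ := by rw [hδ]; linarith
  obtain ⟨ε, hε, hεB⟩ : ∃ ε : ℝ, 0 < ε ∧ ε * |dirichletForm Ω p u ψ| ≤ δ := by
    refine ⟨δ / (|dirichletForm Ω p u ψ| + 1), by positivity, ?_⟩
    rw [div_mul_eq_mul_div, div_le_iff₀ (by positivity)]
    nlinarith
  have hk : ∀ s : ℝ, MemH10 Ω (fun x => φ x + s * ψ x) := fun s => hφ.add_smul hΩ hψ s
  -- the constraint functional has slope `q s ∫ |u| ^ (q - 2) u ψ` in the direction `φ + s ψ`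
  have hslope : ∀ s : ℝ, HasDerivAt
      (fun t : ℝ => ∫ x in Ω, |u x + t * (φ x + s * ψ x)| ^ critExp n)
      (critExp n * (s * ∫ x in Ω, dualPow (critExp n) u x * ψ x)) 0 := by
    intro s
    have h := hasDerivAt_integral_abs_rpow hq huq ((hk s).memLp_critExp hn) 0
    simp only [zero_mul, add_zero] at h
    convert h using 2
    have h1 : ∀ x, dualPow (critExp n) u x * (φ x + s * ψ x) =
        dualPow (critExp n) u x * φ x + s * (dualPow (critExp n) u x * ψ x) := fun x => by ring
    simp only [h1]
    rw [integral_add (integrable_dualPow_mul hq huq hφq)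
      ((integrable_dualPow_mul hq huq hψq).const_mul s), integral_const_mul, hφ0, zero_add]
  have hN0 : ∀ s : ℝ, ∫ x in Ω, |u x + 0 * (φ x + s * ψ x)| ^ critExp n = 1 := fun s => by
    simpa using integral_eq_one_of_mem_admissible hn hu.1
  have hup : ∀ᶠ t : ℝ in 𝓝[>] 0,
      1 < ∫ x in Ω, |u x + t * (φ x + ε * ψ x)| ^ critExp n := by
    have h := eventually_lt_of_hasDerivAt_pos (hslope ε) (by positivity)
    rwa [hN0] at h
  have hdown : ∀ᶠ t : ℝ in 𝓝[>] 0,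
      ∫ x in Ω, |u x + t * (φ x + -ε * ψ x)| ^ critExp n < 1 := by
    have h := eventually_gt_of_hasDerivAt_neg (hslope (-ε))
      (mul_neg_of_pos_of_neg (by linarith) (mul_neg_of_neg_of_pos (by linarith) hψ0))
    rwa [hN0] at h
  set C := energy Ω p φ + 2 * ε * |dirichletForm Ω p φ ψ| + ε ^ 2 * |energy Ω p ψ|
  have hsmall : ∀ᶠ t : ℝ in 𝓝[>] 0, t * C < 2 * δ := by
    have : Tendsto (fun t : ℝ => t * C) (𝓝[>] 0) (𝓝 0) := by
      have h := (continuous_mul_const C).tendsto (0 : ℝ)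
      rw [zero_mul] at h
      exact h.mono_left nhdsWithin_le_nhds
    exact this.eventually_lt_const (by linarith)
  obtain ⟨t, ht, htu, htd, hts⟩ :=
    ((eventually_mem_nhdsWithin.and (hup.and (hdown.and hsmall)))).exists
  have ht0 : 0 < t := ht
  have hcont : Continuous (fun s : ℝ => ∫ x in Ω, |u x + t * (φ x + s * ψ x)| ^ critExp n) := by
    have h := continuous_integral_abs_rpow hq (huq.add (hφq.const_mul t)) (hψq.const_mul t)
    refine h.congr fun s => integral_congr_ae (Eventually.of_forall fun x => ?_)
    simp only [Pi.add_apply]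
    congr 2
    ring
  obtain ⟨s, hs, hs1⟩ := intermediate_value_Icc (by linarith : -ε ≤ ε) hcont.continuousOn
    ⟨htd.le, htu.le⟩
  have hsε : |s| ≤ ε := abs_le.2 hs
  have hmin := hu.nonneg_of_integral_eq_one hn hΩ hp (hk s) hs1
  rw [dirichletForm_comm, dirichletForm_add_smul hΩ hp hφ.1 hψ.1 hu1,
    dirichletForm_comm φ, dirichletForm_comm ψ, energy_add_smul hΩ hp hφ.1 hψ.1] at hmin
  have hb1 : dirichletForm Ω p u φ + s * dirichletForm Ω p u ψ ≤ -δ := by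
    have : s * dirichletForm Ω p u ψ ≤ ε * |dirichletForm Ω p u ψ| := by
      refine (le_abs_self _).trans ?_
      rw [abs_mul]
      gcongr
    linarith
  have hb2 : energy Ω p φ + 2 * s * dirichletForm Ω p φ ψ + s ^ 2 * energy Ω p ψ ≤ C := by
    have h1 : s * dirichletForm Ω p φ ψ ≤ ε * |dirichletForm Ω p φ ψ| := by
      refine (le_abs_self _).trans ?_
      rw [abs_mul]
      gcongr
    have h2 : s ^ 2 * energy Ω p ψ ≤ ε ^ 2 * |energy Ω p ψ| := by
      have : s ^ 2 ≤ ε ^ 2 := sq_le_sq' hs.1 hs.2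
      exact (mul_le_mul_of_nonneg_left (le_abs_self _) (sq_nonneg s)).trans
        (mul_le_mul_of_nonneg_right this (abs_nonneg _))
    linarith
  nlinarith [mul_le_mul_of_nonneg_left hb2 (sq_nonneg t), mul_le_mul_of_nonneg_left hb1 ht0.le,
    mul_lt_mul_of_pos_left hts ht0]

/-! ### The Lagrange multiplier and its sign -/

/-- The constraint `‖u‖_q = 1` is regular at each of its points `u`. -/
theorem exists_isTest_integral_dualPow_pos (hn : 3 ≤ n) (hΩ : IsOpen Ω)
    (hb : Bornology.IsBounded Ω) {u : E n → ℝ} (hu : u ∈ admissible Ω g) :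
    ∃ ψ, IsTest Ω ψ ∧ 0 < ∫ x in Ω, dualPow (critExp n) u x * ψ x := by
  have hq := one_lt_critExp hn
  have huq := memLp_of_mem_admissible hu
  suffices h : ∃ ψ, IsTest Ω ψ ∧ ∫ x in Ω, dualPow (critExp n) u x * ψ x ≠ 0 by
    obtain ⟨ψ, hψ, h0⟩ := h
    rcases h0.lt_or_gt with h0 | h0
    · refine ⟨fun x => ψ x + (-2) * ψ x, hψ.add_smul hψ (-2), ?_⟩
      have h1 : ∀ x, dualPow (critExp n) u x * (ψ x + (-2) * ψ x) =
        -(dualPow (critExp n) u x * ψ x) := fun x => by ring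
      simp only [h1]
      rw [integral_neg]
      linarith
    · exact ⟨ψ, hψ, h0⟩
  by_contra! hall
  have : IsFiniteMeasure (volume.restrict Ω) :=
    isFiniteMeasure_restrict.2 hb.measure_lt_top.ne
  have hint : Integrable (dualPow (critExp n) u) (volume.restrict Ω) := by
    refine (memLp_dualPow hq huq).integrable ?_
    rw [ENNReal.one_le_ofReal]
    exact (holderConjugate_dual hq).lt.le
  have h0 : ∀ᵐ x, x ∈ Ω → dualPow (critExp n) u x = 0 := by
    refine hΩ.ae_eq_zero_of_integral_contDiff_smul_eq_zero
      (locallyIntegrableOn_of_locallyIntegrable_restrict hint.locallyIntegrable)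
      fun φ h1 h2 h3 => ?_
    rw [← hall φ ⟨h1, h2, h3⟩, ← setIntegral_eq_integral_of_forall_compl_eq_zero (s := Ω)
      (fun x hx => by
        rw [image_eq_zero_of_notMem_tsupport fun h => hx (h3 h), zero_smul])]
    simp [mul_comm]
  have h1 := integral_eq_one_of_mem_admissible hn hu
  have h2 : ∫ x in Ω, |u x| ^ critExp n = 0 := by
    refine integral_eq_zero_of_ae ?_
    filter_upwards [(ae_restrict_iff' hΩ.measurableSet).2 h0] with x hx
    rw [← dualPow_mul_self hq, hx, zero_mul, Pi.zero_apply]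
  linarith

theorem IsMinimizer.dirichletForm_eq_zero (hn : 3 ≤ n) (hΩ : IsOpen Ω)
    (hp : MemLp p ⊤ (volume.restrict Ω)) {u φ ψ : E n → ℝ} (hu : IsMinimizer Ω p g u)
    (hφ : MemH10 Ω φ) (hψ : MemH10 Ω ψ)
    (hφ0 : ∫ x in Ω, dualPow (critExp n) u x * φ x = 0)
    (hψ0 : 0 < ∫ x in Ω, dualPow (critExp n) u x * ψ x) : dirichletForm Ω p u φ = 0 := by
  have h1 := hu.dirichletForm_nonneg hn hΩ hp hφ hψ hφ0 hψ0
  have hneg : MemH10 Ω (fun x => φ x + (-2) * φ x) := hφ.add_smul hΩ hφ (-2)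
  have h2 := hu.dirichletForm_nonneg hn hΩ hp hneg hψ (by
    have h1 : ∀ x, dualPow (critExp n) u x * (φ x + (-2) * φ x) =
        -(dualPow (critExp n) u x * φ x) := fun x => by ring
    simp only [h1]
    rw [integral_neg, hφ0, neg_zero]) hψ0
  rw [dirichletForm_comm, dirichletForm_add_smul hΩ hp hφ.1 hφ.1 hu.1.1.2.1,
    dirichletForm_comm φ] at h2
  linarith

theorem eulerLagrange_iff_weakEq {u : E n → ℝ} {Λ : ℝ} :
    EulerLagrange Ω p u Λ ↔ WeakEq Ω p u (fun x => Λ * dualPow (critExp n) u x) :=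
  Iff.rfl

theorem EulerLagrange.dirichletForm_eq (hn : 3 ≤ n) (hΩ : IsOpen Ω)
    (hp : MemLp p ⊤ (volume.restrict Ω)) {u : E n → ℝ} (hu : u ∈ admissible Ω g) {Λ : ℝ}
    (h : EulerLagrange Ω p u Λ) {w : E n → ℝ} (hw : MemH10 Ω w) :
    dirichletForm Ω p u w = Λ * ∫ x in Ω, dualPow (critExp n) u x * w x := by
  rw [WeakEq.dirichletForm_eq hn hΩ hp hu.1.2.1
    ((memLp_dualPow (one_lt_critExp hn) (memLp_of_mem_admissible hu)).const_mul Λ)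
    (eulerLagrange_iff_weakEq.1 h) hw, ← integral_const_mul]
  simp only [mul_assoc]

/-- The Lagrange multiplier rule: the derivatives of the energy and of the constraint at a minimizer
are proportional, and the latter does not vanish. -/
theorem IsMinimizer.existsUnique_eulerLagrange (hn : 3 ≤ n) (hΩ : IsOpen Ω)
    (hb : Bornology.IsBounded Ω) (hp : MemLp p ⊤ (volume.restrict Ω)) {u : E n → ℝ}
    (hu : IsMinimizer Ω p g u) : ∃! Λ : ℝ, EulerLagrange Ω p u Λ := by
  have hq := one_lt_critExp hn
  have huq := memLp_of_mem_admissible hu.1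
  have hu1 := hu.1.1.2.1
  obtain ⟨ψ, hψ, hψ0⟩ := exists_isTest_integral_dualPow_pos hn hΩ hb hu.1
  have hψ1 := hψ.memH10 hΩ
  set N := ∫ x in Ω, dualPow (critExp n) u x * ψ x with hN
  refine ⟨dirichletForm Ω p u ψ / N, ?_, fun Λ hΛ => ?_⟩
  · refine eulerLagrange_iff_weakEq.2 (weakEq_of_dirichletForm_eq hΩ fun φ hφ => ?_)
    have hφ1 := hφ.memH10 hΩ
    set M := ∫ x in Ω, dualPow (critExp n) u x * φ x with hM
    -- `φ - (M / N) ψ` is tangent to the constraint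
    have h := hu.dirichletForm_eq_zero hn hΩ hp (hφ1.add_smul hΩ hψ1 (-(M / N))) hψ1 (by
      have h1 : ∀ x, dualPow (critExp n) u x * (φ x + -(M / N) * ψ x) =
        dualPow (critExp n) u x * φ x + -(M / N) * (dualPow (critExp n) u x * ψ x) :=
          fun x => by ring
      simp only [h1]
      rw [integral_add (integrable_dualPow_mul hq huq (hφ.memLp _))
        ((integrable_dualPow_mul hq huq (hψ.memLp _)).const_mul _), integral_const_mul, ← hM, ← hN]
      field_simp
      ring) hψ0
    rw [dirichletForm_comm, dirichletForm_add_smul hΩ hp hφ1.1 hψ1.1 hu1,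
      dirichletForm_comm φ, dirichletForm_comm ψ] at h
    simp only [mul_assoc]
    rw [integral_const_mul, ← hM]
    linear_combination h
  · rw [hΛ.dirichletForm_eq hn hΩ hp hu.1 hψ1, ← hN]
    field_simp

/-- The hypothesis `hE` holds when `v` solves the Dirichlet problem: it makes the energy strictly
decreasing on the segment from `u` to `v`. The constraint functional, which exceeds `1` at `v`, then
cannot decrease at the start of the segment, or it would take the value `1` again further on. -/
theorem IsMinimizer.integral_dualPow_mul_sub_nonpos (hn : 3 ≤ n) (hΩ : IsOpen Ω)
    (hp : MemLp p ⊤ (volume.restrict Ω)) {u v : E n → ℝ} (hu : IsMinimizer Ω p g u)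
    (hw : MemH10 Ω (fun x => u x - v x)) (hD : 0 < energy Ω p (fun x => u x - v x))
    (hE : dirichletForm Ω p u (fun x => u x - v x) = energy Ω p (fun x => u x - v x))
    (hv : 1 < ∫ x in Ω, |v x| ^ critExp n) :
    ∫ x in Ω, dualPow (critExp n) u x * (u x - v x) ≤ 0 := by
  by_contra! hpos
  have hq := one_lt_critExp hn
  have huq := memLp_of_mem_admissible hu.1
  have hwq := hw.memLp_critExp hn
  set N : ℝ → ℝ := fun t => ∫ x in Ω, |u x + t * (-(u x - v x))| ^ critExp n with hN
  have hder : HasDerivAt N _ 0 := hasDerivAt_integral_abs_rpow hq huq hwq.neg 0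
  have hneg : critExp n * (∫ x in Ω, dualPow (critExp n) (fun x => u x + 0 * (-(u x - v x))) x *
      (-(u x - v x))) < 0 := by
    simp only [mul_neg, zero_mul, neg_zero, add_zero]
    rw [integral_neg]
    nlinarith
  have hN0 : N 0 = 1 := by
    simpa [hN] using integral_eq_one_of_mem_admissible hn hu.1
  have hdown := eventually_gt_of_hasDerivAt_neg hder hneg
  rw [hN0] at hdown
  obtain ⟨t₀, h0, ht₀⟩ := (hdown.and (Ioo_mem_nhdsGT zero_lt_one)).exists
  have hN1 : N 1 = ∫ x in Ω, |v x| ^ critExp n := by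
    simp only [hN]
    refine integral_congr_ae (Eventually.of_forall fun x => ?_)
    simp
  obtain ⟨t, ht, ht1⟩ := intermediate_value_Icc ht₀.2.le
    (continuous_integral_abs_rpow hq huq hwq.neg).continuousOn
    (show (1 : ℝ) ∈ Icc (N t₀) (N 1) from ⟨h0.le, by rw [hN1]; exact hv.le⟩)
  have h1 := hu.nonneg_of_integral_eq_one hn hΩ hp hw (t := -t) (by
    rw [← ht1]
    refine integral_congr_ae (Eventually.of_forall fun x => ?_)
    simp only [Pi.neg_apply]
    congr 2
    ring)
  rw [hE] at h1
  have ht0 : 0 < t := ht₀.1.trans_le ht.1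
  nlinarith [mul_pos ht0 hD, ht.2, mul_nonneg (mul_pos ht0 hD).le (sub_nonneg.2 ht.2)]

/-- Testing the equations of `u` and `v` with `u - v` gives `energy (u - v) = Λ (1 - ∫ |u|^(q-2) u v)`,
from which the sign of `Λ` is read off. -/
theorem IsMinimizer.sign_multiplier (hn : 3 ≤ n) (hΩ : IsOpen Ω)
    (hb : Bornology.IsBounded Ω) (hp : MemLp p ⊤ (volume.restrict Ω))
    (hpos : ∀ᵐ x ∂(volume.restrict Ω), 0 < p x) {u v : E n → ℝ}
    (hv : SolvesDirichlet Ω p g v) (hu : IsMinimizer Ω p g u) {Λ : ℝ}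
    (hΛ : EulerLagrange Ω p u Λ) :
    (critNorm Ω v < 1 → 0 < Λ) ∧ (1 < critNorm Ω v → Λ < 0) ∧ (critNorm Ω v = 1 → Λ = 0) := by
  have hq := one_lt_critExp hn
  have huq := memLp_of_mem_admissible hu.1
  have hu1 := hu.1.1.2.1
  have hv1 := hv.1.2.1
  have hw := sub_memH10 hΩ hu.1.1 hv.1
  have hwq := hw.memLp_critExp hn
  set w : E n → ℝ := fun x => u x - v x with hwdef
  have hvq : MemLp v (ENNReal.ofReal (critExp n)) (volume.restrict Ω) := by
    convert huq.sub hwq using 1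
    ext x
    simp [hwdef]
  have hvform : ∀ φ, MemH10 Ω φ → dirichletForm Ω p v φ = 0 := fun φ hφ => by
    have h := hv.2.dirichletForm_eq hn hΩ hp hv1 MemLp.zero' hφ
    simpa using h
  have hsub : ∀ φ, MemH1 Ω φ →
      dirichletForm Ω p w φ = dirichletForm Ω p u φ - dirichletForm Ω p v φ := fun φ hφ => by
    have h := dirichletForm_add_smul hΩ hp hu1 hv1 hφ (-1)
    simp only [neg_one_mul, ← sub_eq_add_neg] at h
    exact h
  have hE : dirichletForm Ω p u w = energy Ω p w := by
    rw [← dirichletForm_self, hsub w hw.1, hvform w hw, sub_zero]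
  have hEL := hΛ.dirichletForm_eq hn hΩ hp hu.1 hw
  rw [hE] at hEL
  have hI : ∫ x in Ω, dualPow (critExp n) u x * w x =
      1 - ∫ x in Ω, dualPow (critExp n) u x * v x := by
    rw [← integral_eq_one_of_mem_admissible hn hu.1, ← integral_sub (integrable_abs_rpow hq huq)
      (integrable_dualPow_mul hq huq hvq)]
    refine integral_congr_ae (Eventually.of_forall fun x => ?_)
    simp only [hwdef, mul_sub, dualPow_mul_self hq]
  have hD0 := energy_nonneg hpos w
  have hDpos : critNorm Ω v ≠ 1 → 0 < energy Ω p w := by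
    intro hne
    refine hD0.lt_of_ne' fun h0 => hne ?_
    have hae := hw.ae_eq_zero hn (weakGrad_ae_eq_zero_of_energy_eq_zero hp hpos hw.1 h0)
    rw [← hu.1.2, critNorm, critNorm]
    refine eLpNorm_congr_ae ?_
    filter_upwards [hae] with x hx
    exact (sub_eq_zero.1 hx).symm
  refine ⟨fun h => ?_, fun h => ?_, fun h => ?_⟩
  · have hlt := integral_dualPow_mul_lt_one hq huq hvq
      (integral_eq_one_of_mem_admissible hn hu.1) ((eLpNorm_lt_one_iff_integral hq hvq).1 h)
    have hD := hDpos h.ne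
    rw [hEL] at hD
    exact pos_of_mul_pos_left hD (by rw [hI]; linarith)
  · have hD := hDpos h.ne'
    have hle := hu.integral_dualPow_mul_sub_nonpos hn hΩ hp hw hD hE
      ((one_lt_eLpNorm_iff_integral hq hvq).1 h)
    rw [hEL] at hD
    by_contra! hΛ0
    exact absurd (mul_nonpos_of_nonneg_of_nonpos hΛ0 hle) (not_le.2 hD)
  · -- `v` itself is admissible, so that `u = v`
    have h1 := hu.nonneg_of_integral_eq_one hn hΩ hp hw (t := -1) (by
      refine Eq.trans ?_ ((eLpNorm_eq_one_iff_integral hq hvq).1 h)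
      refine integral_congr_ae (Eventually.of_forall fun x => ?_)
      simp [hwdef])
    rw [hE] at h1
    have h0 : energy Ω p w = 0 := le_antisymm (by linarith) hD0
    have hg := weakGrad_ae_eq_zero_of_energy_eq_zero hp hpos hw.1 h0
    obtain ⟨ψ, hψ, hψ0⟩ := exists_isTest_integral_dualPow_pos hn hΩ hb hu.1
    have hψ1 := hψ.memH10 hΩ
    have hz : dirichletForm Ω p w ψ = 0 := by
      refine integral_eq_zero_of_ae ?_
      filter_upwards [hg] with x hx
      simp [hx]
    rw [hsub ψ hψ1.1, hvform ψ hψ1, sub_zero, hΛ.dirichletForm_eq hn hΩ hp hu.1 hψ1] at hz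
    exact (mul_eq_zero.1 hz).resolve_right hψ0.ne'

end Minimizer

end CriticalDirichlet

theorem theorem3p1 (n : ℕ) (hn : 3 ≤ n)
    (Ω : Set (CriticalDirichlet.E n)) (hΩ : CriticalDirichlet.IsBoundedC1Domain Ω)
    (p : CriticalDirichlet.E n → ℝ) (c₁ c₂ : ℝ) (hc₁ : 0 < c₁)
    (hp : ∀ x ∈ closure Ω, c₁ ≤ p x ∧ p x ≤ c₂)
    (hpH1 : CriticalDirichlet.MemH1 Ω p) (hpC : ContinuousOn p (closure Ω))
    (g : frontier Ω → ℝ) (hg : CriticalDirichlet.IsBoundaryDatum Ω g)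
    (v : CriticalDirichlet.E n → ℝ) (hv : CriticalDirichlet.SolvesDirichlet Ω p g v)
    (u : CriticalDirichlet.E n → ℝ) (hu : CriticalDirichlet.IsMinimizer Ω p g u) :
    (∃! Λ : ℝ, CriticalDirichlet.EulerLagrange Ω p u Λ) ∧
    ∀ Λ : ℝ, CriticalDirichlet.EulerLagrange Ω p u Λ →
      (CriticalDirichlet.critNorm Ω v < 1 → 0 < Λ) ∧
      (1 < CriticalDirichlet.critNorm Ω v → Λ < 0) ∧
      (CriticalDirichlet.critNorm Ω v = 1 → Λ = 0) := by
  have hbd : ∀ᵐ x ∂(volume.restrict Ω), c₁ ≤ p x ∧ p x ≤ c₂ :=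
    (ae_restrict_iff' hΩ.isOpen.measurableSet).2
      (Filter.Eventually.of_forall fun x hx => hp x (subset_closure hx))
  have hpos : ∀ᵐ x ∂(volume.restrict Ω), 0 < p x := hbd.mono fun x hx => hc₁.trans_le hx.1
  have hpm : MemLp p ⊤ (volume.restrict Ω) := by
    refine memLp_top_of_bound hpH1.1.aestronglyMeasurable c₂ ?_
    filter_upwards [hbd, hpos] with x hx hx'
    rw [Real.norm_eq_abs, abs_of_pos hx']
    exact hx.2
  exact ⟨hu.existsUnique_eulerLagrange hn hΩ.isOpen hΩ.isBounded hpm,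
    fun Λ hΛ => hu.sign_multiplier hn hΩ.isOpen hΩ.isBounded hpm hpos hv hΛ⟩
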